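/- **Setting.** A linear relation in a complex Hilbert space $H$ is a linear subspace of $H\times H$; for such a relation $A$ and $x\in\mathbb R$ put $\ker(A-x):=\{f\in H:\ (f;xf)\in A\}$, let $\sigma_p(A)$ be the set of $x$ with $\ker(A-x)\neq\{0\}$, and call $\dim\ker(A-x)$ the multiplicity of the eigenvalue $x$. A closed symmetric relation $S$ is called simple if there is no orthogonal decomposition $H=K\oplus K^\perp$, $S=(S\cap K^2)\oplus(S\cap (K^\perp)^2)$ with $K\neq\{0\}$ and $S\cap K^2$ selfadjoint in $K$. A boundary relation for $S^*$ with boundary space $B$ is a linear subspace $\Gamma\subseteq H^2\times B^2$ whose domain $\{(f;g):\ \exists\,(\alpha;\beta),\ ((f;g);(\alpha;\beta))\in\Gamma\}$ is a dense subset of $S^*$, whose elements satisfy pairwise Green's identity $$(g,f')_H-(f,g')_H=(\beta,\alpha')_B-(\alpha,\beta')_B ,$$ and which is maximal in the sense that every element of $H^2\times B^2$ satisfying this identity with all elements of $\Gamma$ belongs to $\Gamma$. Put $\operatorname{mul}\Gamma:=\{(\alpha;\beta):\ ((0;0);(\alpha;\beta))\in\Gamma\}$. The relation $\Gamma$ is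 of function type if $\operatorname{mul}\Gamma\cap(\{0\}\times B)=\{0\}$, and is a boundary function if $\operatorname{mul}\Gamma=\{0\}$. Write $\ker[\pi_1\circ\Gamma]:=\{(f;g):\ \exists\,\beta,\ ((f;g);(0;\beta))\in\Gamma\}$. If $B=\mathbb C$ and $\Gamma$ is of function type, its Weyl function $m$ assigns to $z\in\mathbb C\setminus\mathbb R$ the unique number $m(z)$ such that $((f;zf);(1;m(z)))\in\Gamma$ for some $f\in H$. **Theorem.** Let $n\ge 2$, and for each $l\in\{1,\dots,n\}$ let $S_l$ be a closed symmetric simple linear relation in a Hilbert space $H_l$ and $\Gamma_l\subseteq H_l^2\times\mathbb C^2$ a boundary relation for $S_l^*$ of function type with Weyl function $m_l$. Assume that at least one $\Gamma_l$ is a boundary function. Put $A_l:=\ker[\pi_1\circ\Gamma_l]$, and let $A:=\ker[\pi_1\circ\Gamma]$ be the pasting of $\Gamma_1,\dots,\Gamma_n$ with standard interface conditions, where $\Gamma\subseteq\big(\prod_l H_l\big)^2\times(\mathbb C^n)^2$ consists of all elements $$\Big(\big((f_l)_l;(g_l)_l\big);\big((-\alpha_1+\alpha_n,\dots,-\alpha_{n-1}+\alpha_n,\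 \beta_1+\dots+\beta_n);(-\beta_1,\dots,-\beta_{n-1},-\alpha_n)\big)\Big)$$ with $((f_l;g_l);(\alpha_l;\beta_l))\in\Gamma_l$ for $l=1,\dots,n$. Let $x\in\mathbb R$. Then $x\in\sigma_p(A)$ if and only if one of the following two alternatives takes place. (I/II) The point $x$ belongs to at least two of the point spectra $\sigma_p(A_l)$. In this case the multiplicity of the eigenvalue $x$ of $A$ is $$\#\{l:\ x\in\sigma_p(A_l)\}-1=\#\Big\{l:\ \lim_{\varepsilon\downarrow0}\varepsilon\,\operatorname{Im}m_l(x+i\varepsilon)>0\Big\}-1 .$$ (III) For all $l$ the limit $m_l(x):=\lim_{\varepsilon\downarrow0}m_l(x+i\varepsilon)$ exists and is real, the limit $\lim_{\varepsilon\downarrow0}\frac1{i\varepsilon}\big(m_l(x+i\varepsilon)-m_l(x)\big)$ exists and lies in $[0,\infty)$, and $\sum_{l=1}^n m_l(x)=0$. In this case $x$ is a simple eigenvalue of $A$, i.e. its multiplicity is $1$. -/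

import Mathlib

open Filter Topology

/-! Linear relations in `E` are submodules of `E × E`; a pair `(f; g)` is `(f, g)`. The adjoint of a
linear relation is Mathlib's `Submodule.adjoint`. -/

noncomputable section

namespace Pasting

section Relations

variable {E : Type*} [NormedAddCommGroup E] [InnerProductSpace ℂ E]

/-- A linear relation is symmetric if it is contained in its adjoint. -/
def IsSymmetricRel (S : Submodule ℂ (E × E)) : Prop :=
  S ≤ S.adjoint

/-- A linear relation is selfadjoint if it equals its adjoint. -/
def IsSelfAdjointRel (S : Submodule ℂ (E × E)) : Prop :=
  S.adjoint = S

/-- The part `S ∩ K²` of a linear relation in a subspace `K`, as a relation in `E`. -/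
def part (S : Submodule ℂ (E × E)) (K : Submodule ℂ E) : Submodule ℂ (E × E) :=
  S ⊓ K.prod K

/-- The part `S ∩ K²` of a linear relation in a subspace `K`, as a relation in `K`. -/
def partIn (S : Submodule ℂ (E × E)) (K : Submodule ℂ E) : Submodule ℂ (K × K) :=
  S.comap (K.subtype.prodMap K.subtype)

/-- A linear relation is simple (completely non-selfadjoint) if there is no orthogonal decomposition
`E = K ⊕ Kᗮ`, `S = (S ∩ K²) ⊕ (S ∩ (Kᗮ)²)` with `K ≠ {0}` such that the part of `S` in `K` is
selfadjoint. -/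
def IsSimpleRel (S : Submodule ℂ (E × E)) : Prop :=
  ∀ K : Submodule ℂ E, IsClosed (K : Set E) →
    S = part S K ⊔ part S Kᗮ → IsSelfAdjointRel (partIn S K) → K = ⊥

/-- `ker (A - x)` for a linear relation `A`: all `f` with `(f; x f) ∈ A`. -/
def eigenspace (A : Submodule ℂ (E × E)) (x : ℂ) : Submodule ℂ E :=
  A.comap (LinearMap.prod LinearMap.id (x • LinearMap.id))

/-- The point spectrum of a linear relation. -/
def pointSpectrum (A : Submodule ℂ (E × E)) : Set ℂ :=
  {x | eigenspace A x ≠ ⊥}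

/-- The multiplicity of a point as an eigenvalue, the dimension of `ker (A - x)`. -/
def eigenMultiplicity (A : Submodule ℂ (E × E)) (x : ℂ) : Cardinal :=
  Module.rank ℂ (eigenspace A x)

theorem mem_eigenspace (A : Submodule ℂ (E × E)) (x : ℂ) (f : E) :
    f ∈ eigenspace A x ↔ (f, x • f) ∈ A :=
  Iff.rfl

end Relations

section BoundaryRelations

variable {E : Type*} [NormedAddCommGroup E] [InnerProductSpace ℂ E]
variable {B : Type*} [NormedAddCommGroup B] [InnerProductSpace ℂ B]

/-- Two elements `((f; g); (α; β))` and `((f'; g'); (α'; β'))` satisfy the abstract Green's identity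
`(g, f') - (f, g') = (β, α') - (α, β')`, where `(·, ·)` is linear in the first argument
(Mathlib's `inner` is linear in the second one). -/
def Green (p q : (E × E) × (B × B)) : Prop :=
  inner ℂ q.1.1 p.1.2 - inner ℂ q.1.2 p.1.1 = inner ℂ q.2.1 p.2.2 - inner ℂ q.2.2 p.2.1

/-- `Γ ⊆ E² × B²` is a boundary relation for `S*`. -/
structure IsBoundaryRelation (S : Submodule ℂ (E × E)) (Γ : Submodule ℂ ((E × E) × (B × B))) :
    Prop where
  /-- The domain of `Γ` is contained in `S*`. -/
  dom_le : ∀ p ∈ Γ, p.1 ∈ S.adjoint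
  /-- The domain of `Γ` is dense in `S*`. -/
  dom_dense : (S.adjoint : Set (E × E)) ⊆ closure (Prod.fst '' (Γ : Set ((E × E) × (B × B))))
  /-- Green's identity. -/
  green : ∀ p ∈ Γ, ∀ q ∈ Γ, Green p q
  /-- Maximality: an element satisfying Green's identity with all elements of `Γ` is in `Γ`. -/
  maximal : ∀ q, (∀ p ∈ Γ, Green p q) → q ∈ Γ

/-- `Γ` is of function type: `mul Γ ∩ ({0} × B) = {0}`. -/
def IsFunctionType (Γ : Submodule ℂ ((E × E) × (B × B))) : Prop :=
  ∀ β : B, ((0, 0), (0, β)) ∈ Γ → β = 0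

/-- `Γ` is a boundary function: `mul Γ = {0}`. -/
def IsBoundaryFunction (Γ : Submodule ℂ ((E × E) × (B × B))) : Prop :=
  ∀ α β : B, ((0, 0), (α, β)) ∈ Γ → α = 0 ∧ β = 0

/-- The relation `ker (π₁ ∘ Γ)`: all `(f; g)` with `((f; g); (0; β)) ∈ Γ` for some `β`. -/
def kerPi₁ (Γ : Submodule ℂ ((E × E) × (B × B))) : Submodule ℂ (E × E) where
  carrier := {p | ∃ β : B, (p, (0, β)) ∈ Γ}
  zero_mem' := ⟨0, Γ.zero_mem⟩
  add_mem' := by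
    rintro p q ⟨β, hp⟩ ⟨γ, hq⟩
    exact ⟨β + γ, by simpa using Γ.add_mem hp hq⟩
  smul_mem' := by
    rintro c p ⟨β, hp⟩
    exact ⟨c • β, by simpa using Γ.smul_mem c hp⟩

/-- The Weyl family: `M(z)` consists of all `(α; β)` with `((f; z f); (α; β)) ∈ Γ` for some `f`. -/
def weylFamily (Γ : Submodule ℂ ((E × E) × (B × B))) (z : ℂ) : Set (B × B) :=
  {b | ∃ f : E, ((f, z • f), b) ∈ Γ}

/-- The Weyl function for `B = ℂ`: the number `m(z)` with `(1; m(z)) ∈ M(z)`. For a boundary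
relation of function type and nonreal `z`, the relation `M(z)` is the graph of multiplication by
`m(z)`. -/
def weylFunction (Γ : Submodule ℂ ((E × E) × (ℂ × ℂ))) (z : ℂ) : ℂ :=
  Classical.epsilon fun β : ℂ => ((1 : ℂ), β) ∈ weylFamily Γ z

end BoundaryRelations

section Paste

variable {n : ℕ} {H : Fin n → Type*} [∀ l, NormedAddCommGroup (H l)]
  [∀ l, InnerProductSpace ℂ (H l)]

/-- The largest index. -/
def lastIdx (hn : 2 ≤ n) : Fin n :=
  ⟨n - 1, by omega⟩

/-- The first boundary component `(-α₁ + αₙ, …, -αₙ₋₁ + αₙ, β₁ + ⋯ + βₙ)`. -/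
def pasteFst (hn : 2 ≤ n) (α β : Fin n → ℂ) : EuclideanSpace ℂ (Fin n) :=
  WithLp.toLp 2 fun l => if l = lastIdx hn then ∑ k, β k else -α l + α (lastIdx hn)

/-- The second boundary component `(-β₁, …, -βₙ₋₁, -αₙ)`. -/
def pasteSnd (hn : 2 ≤ n) (α β : Fin n → ℂ) : EuclideanSpace ℂ (Fin n) :=
  WithLp.toLp 2 fun l => if l = lastIdx hn then -α l else -β l

/-- The boundary relation in `(∏ H_l)² × (ℂⁿ)²` obtained from `Γ₁, …, Γₙ` with standard interface
conditions; `PiLp 2 H` is the Hilbert space product. -/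
def pasteRel (hn : 2 ≤ n) (Γ : ∀ l, Submodule ℂ ((H l × H l) × (ℂ × ℂ))) :
    Submodule ℂ ((PiLp 2 H × PiLp 2 H) ×
      (EuclideanSpace ℂ (Fin n) × EuclideanSpace ℂ (Fin n))) where
  carrier := {p | ∃ α β : Fin n → ℂ, (∀ l, ((p.1.1 l, p.1.2 l), (α l, β l)) ∈ Γ l) ∧
    p.2 = (pasteFst hn α β, pasteSnd hn α β)}
  zero_mem' := by
    refine ⟨0, 0, fun l => (Γ l).zero_mem, ?_⟩
    ext l <;> simp [pasteFst, pasteSnd]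
  add_mem' := by
    rintro p q ⟨α, β, hp, hp'⟩ ⟨α', β', hq, hq'⟩
    refine ⟨α + α', β + β', fun l => by simpa using (Γ l).add_mem (hp l) (hq l), ?_⟩
    rw [Prod.snd_add, hp', hq']
    ext l
    · by_cases h : l = lastIdx hn
      · simp [pasteFst, h, Finset.sum_add_distrib]
      · simp [pasteFst, h]; ring
    · by_cases h : l = lastIdx hn
      · simp [pasteSnd, h]; ring
      · simp [pasteSnd, h]; ring
  smul_mem' := by
    rintro c p ⟨α, β, hp, hp'⟩
    refine ⟨c • α, c • β, fun l => by simpa using (Γ l).smul_mem c (hp l), ?_⟩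
    rw [Prod.smul_snd, hp']
    ext l
    · by_cases h : l = lastIdx hn
      · simp [pasteFst, h, Finset.mul_sum]
      · simp [pasteFst, h]; ring
    · by_cases h : l = lastIdx hn <;> simp [pasteSnd, h]

/-- The relation constructed by pasting `Γ₁, …, Γₙ` with standard interface conditions. -/
def pasting (hn : 2 ≤ n) (Γ : ∀ l, Submodule ℂ ((H l × H l) × (ℂ × ℂ))) :
    Submodule ℂ (PiLp 2 H × PiLp 2 H) :=
  kerPi₁ (pasteRel hn Γ)

/-- At least two of the relations `A_l = ker (π₁ ∘ Γ_l)` have the eigenvalue `x`. -/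
def AlternativeOverlap (Γ : ∀ l, Submodule ℂ ((H l × H l) × (ℂ × ℂ))) (x : ℝ) : Prop :=
  2 ≤ {l : Fin n | (x : ℂ) ∈ pointSpectrum (kerPi₁ (Γ l))}.ncard

/-- The normal limits `m_l(x)` of the Weyl functions all exist and are real (`m l = m_l(x)`), the
normal derivatives `lim (m_l(x + iε) - m_l(x)) / (iε)` exist in `[0, ∞)`, and `∑ m_l(x) = 0`. -/
def AlternativeNew (Γ : ∀ l, Submodule ℂ ((H l × H l) × (ℂ × ℂ))) (x : ℝ) : Prop :=
  ∃ m : Fin n → ℝ,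
    (∀ l, Tendsto (fun ε : ℝ => weylFunction (Γ l) (x + Complex.I * ε)) (𝓝[>] 0) (𝓝 (m l : ℂ))) ∧
    (∀ l, ∃ d : ℝ, 0 ≤ d ∧
      Tendsto (fun ε : ℝ => 1 / (Complex.I * ε) *
        (weylFunction (Γ l) (x + Complex.I * ε) - m l)) (𝓝[>] 0) (𝓝 (d : ℂ))) ∧
    ∑ l, m l = 0

end Paste

end Pasting

end

/-! An eigenvector of the pasting at `x` is a nonzero tuple of solutions `((f_l; x f_l); (a; β_l))`
in `Γ l` with a common first boundary value `a` and `∑ β_l = 0` (`mem_eigenspace_pasting_iff`). By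
simplicity, a solution at a real point is determined by its boundary values
(`IsBoundaryRelation.eq_zero_of_mem`). If `x` is an eigenvalue of some `A_l`, Green's identity
against its eigenvector forces `a = 0` (`boundary_fst_eq_zero`). The `β_l` are then free coordinates
on the eigenspaces of the `A_l`, each of dimension at most one, and the condition on their sum
removes one dimension. If `a ≠ 0`, scale to `a = 1`. The solution is then unique, and it remains to
decide for which real `β` a solution with boundary values `(1; β)` exists. This is read off from the
Weyl solutions `γ ε` at `x + iε`, whose boundary values are `(1; m ε)`. Green's identity between two
of them gives `‖γ ε‖² = Im (m ε) / ε` and bounds `‖γ ε - γ δ‖²` by the difference of the squared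
norms. Hence convergence of the squared norms gives convergence of the vectors, and the limit solves
at `x` because `Γ` is closed (`exists_solution_iff`). The norms of `ε γ ε` are monotone, so these
vectors always converge; their limit is nonzero exactly when `x` is an eigenvalue of `A_l`
(`mem_pointSpectrum_kerPi₁_iff_tendsto`). -/

namespace Pasting

open ComplexConjugate

/-! ### Closed relations and simplicity -/

section Adjoint

variable {E : Type*} [NormedAddCommGroup E] [InnerProductSpace ℂ E] [CompleteSpace E]

/-- A closed linear relation contains its second adjoint. -/
theorem mem_of_forall_mem_adjoint {S : Submodule ℂ (E × E)} (hS : IsClosed (S : Set (E × E)))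
    {p : E × E} (hp : ∀ q ∈ S.adjoint, inner ℂ q.2 p.1 - inner ℂ q.1 p.2 = 0) : p ∈ S := by
  -- `E × E` carries the sup norm; orthogonal complements need the Hilbert space product.
  let T : Submodule ℂ (WithLp 2 (E × E)) :=
    S.comap (WithLp.linearEquiv 2 ℂ (E × E)).toLinearMap
  have hT : IsClosed (T : Set (WithLp 2 (E × E))) :=
    hS.preimage (WithLp.prod_continuous_ofLp 2 E E)
  have hTT : Tᗮᗮ = T := by
    rw [Submodule.orthogonal_orthogonal_eq_closure]
    exact hT.submodule_topologicalClosure_eq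
  suffices h : WithLp.toLp 2 p ∈ Tᗮᗮ by
    rw [hTT] at h
    exact h
  rw [Submodule.mem_orthogonal]
  intro u hu
  rw [Submodule.mem_orthogonal] at hu
  -- The adjoint is the orthogonal complement rotated by a right angle.
  have key : (u.snd, -u.fst) ∈ S.adjoint := by
    rw [Submodule.mem_adjoint_iff]
    intro a b hab
    have := hu (WithLp.toLp 2 (a, b)) hab
    simp only [WithLp.prod_inner_apply] at this
    simp only [inner_neg_right, sub_neg_eq_add]
    rw [add_comm]
    exact this
  have := hp _ key
  simp only [inner_neg_left] at this
  rw [WithLp.prod_inner_apply]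
  change inner ℂ u.fst p.1 + inner ℂ u.snd p.2 = 0
  linear_combination -this

end Adjoint

section Simple

variable {E : Type*} [NormedAddCommGroup E] [InnerProductSpace ℂ E]

/-- A simple symmetric relation has no real eigenvalues. -/
theorem IsSimpleRel.eq_zero_of_mem {S : Submodule ℂ (E × E)} (hsimple : IsSimpleRel S)
    (hsymm : IsSymmetricRel S) {f : E} {x : ℝ} (hf : (f, (x : ℂ) • f) ∈ S) : f = 0 := by
  by_contra hf0
  have hff : inner ℂ f f ≠ 0 := inner_self_ne_zero.2 hf0
  have hsym : ∀ {u v : E}, (u, v) ∈ S → inner ℂ f v = x * inner ℂ f u := by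
    intro u v huv
    have := (Submodule.mem_adjoint_iff _ _).1 (hsymm huv) f _ hf
    simp only [inner_smul_left, Complex.conj_ofReal] at this
    linear_combination -this
  have hmul : ∀ {a b : E}, (a, b) ∈ S → a ∈ ℂ ∙ f → b ∈ ℂ ∙ f → b = (x : ℂ) • a := by
    intro a b hab ha hb
    obtain ⟨c, rfl⟩ := Submodule.mem_span_singleton.1 ha
    obtain ⟨d, rfl⟩ := Submodule.mem_span_singleton.1 hb
    have h := hsym hab
    simp only [inner_smul_right] at h
    have hd : d = x * c := mul_right_cancel₀ hff (by linear_combination h)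
    rw [hd, smul_smul]
  have hspan : ∀ {a : E}, a ∈ ℂ ∙ f → (a, (x : ℂ) • a) ∈ S := by
    intro a ha
    obtain ⟨c, rfl⟩ := Submodule.mem_span_singleton.1 ha
    have := S.smul_mem c hf
    rwa [Prod.smul_mk, smul_comm] at this
  -- The line through `f` reduces `S`, and the part there is multiplication by the real number `x`,
  -- which is selfadjoint.
  have hK := hsimple (ℂ ∙ f) (Submodule.closed_of_finiteDimensional _) ?_ ?_
  · exact hf0 (Submodule.span_singleton_eq_bot.1 hK)
  · refine le_antisymm ?_ (sup_le inf_le_left inf_le_left)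
    rintro ⟨u, v⟩ huv
    set c : ℂ := inner ℂ f u / inner ℂ f f with hc
    have hcf : c • f ∈ ℂ ∙ f := Submodule.smul_mem _ _ (Submodule.mem_span_singleton_self f)
    have hcc : c * inner ℂ f f = inner ℂ f u := div_mul_cancel₀ _ hff
    have h1 : (c • f, (x : ℂ) • c • f) ∈ S := hspan hcf
    have h2 : (u - c • f, v - (x : ℂ) • c • f) ∈ S := S.sub_mem huv h1
    refine Submodule.mem_sup.2 ⟨_, ⟨h1, hcf, Submodule.smul_mem _ _ hcf⟩, _, ⟨h2, ?_, ?_⟩, ?_⟩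
    · rw [SetLike.mem_coe, Submodule.mem_orthogonal_singleton_iff_inner_right]
      simp only [inner_sub_right, inner_smul_right]
      linear_combination -hcc
    · rw [SetLike.mem_coe, Submodule.mem_orthogonal_singleton_iff_inner_right]
      simp only [inner_sub_right, inner_smul_right]
      linear_combination hsym huv - x * hcc
    · simp
  · refine le_antisymm ?_ ?_
    · rintro ⟨a, b⟩ hab
      rw [Submodule.mem_adjoint_iff] at hab
      have hb : b = (x : ℂ) • a := by
        refine ext_inner_left ℂ fun k => ?_
        have := hab k ((x : ℂ) • k) (hspan k.2)
        simp only [inner_smul_left, Complex.conj_ofReal] at this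
        rw [inner_smul_right]
        linear_combination -this
      subst hb
      exact hspan a.2
    · rintro ⟨a, b⟩ hab
      rw [Submodule.mem_adjoint_iff]
      rintro k l hkl
      have h1 : b = (x : ℂ) • a := Subtype.ext (hmul hab a.2 b.2)
      have h2 : l = (x : ℂ) • k := Subtype.ext (hmul hkl k.2 l.2)
      rw [h1, h2, inner_smul_left, inner_smul_right, Complex.conj_ofReal, sub_self]

end Simple

/-! ### Green's identity and solvability at nonreal points -/

section Solutions

variable {E : Type*} [NormedAddCommGroup E] [InnerProductSpace ℂ E]
variable {Γ : Submodule ℂ ((E × E) × (ℂ × ℂ))}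

theorem inner_self_eq_ofReal (u : E) : inner ℂ u u = ((‖u‖ ^ 2 : ℝ) : ℂ) := by
  rw [inner_self_eq_norm_sq_to_K, Complex.ofReal_pow]
  rfl

theorem green_solutions (hg : ∀ p ∈ Γ, ∀ q ∈ Γ, Green p q) {f g : E} {z w α β α' β' : ℂ}
    (hf : ((f, z • f), (α, β)) ∈ Γ) (hg' : ((g, w • g), (α', β')) ∈ Γ) :
    (z - conj w) * inner ℂ g f = β * conj α' - α * conj β' := by
  have := hg _ hf _ hg'
  simp only [Green, inner_smul_left, inner_smul_right, RCLike.inner_apply] at this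
  linear_combination this

/-- Maximality makes `Γ` an intersection of the sets cut out by Green's identity with a fixed
element, each of which is closed. -/
theorem isClosed_of_maximal (hg : ∀ p ∈ Γ, ∀ q ∈ Γ, Green p q)
    (hm : ∀ q, (∀ p ∈ Γ, Green p q) → q ∈ Γ) :
    IsClosed (Γ : Set ((E × E) × (ℂ × ℂ))) := by
  have : (Γ : Set ((E × E) × (ℂ × ℂ))) = ⋂ p ∈ Γ, {q | Green p q} := by
    ext q
    simp only [SetLike.mem_coe, Set.mem_iInter, Set.mem_ofPred_eq]
    exact ⟨fun hq p hp => hg p hp q hq, hm q⟩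
  rw [this]
  refine isClosed_biInter fun p _ => ?_
  unfold Green
  exact isClosed_eq (by fun_prop) (by fun_prop)

/-- For nonreal `z` the vector `(0; 1)` is in the range of `Ã - z`, where `Ã` is the selfadjoint
relation `{((f, α); (g, -β))}` in `E × ℂ` that corresponds to `Γ`. -/
theorem exists_resolvent_mem [CompleteSpace E] (hg : ∀ p ∈ Γ, ∀ q ∈ Γ, Green p q)
    (hm : ∀ q, (∀ p ∈ Γ, Green p q) → q ∈ Γ) {z : ℂ} (hz : z.im ≠ 0) :
    ∃ f α, ((f, z • f), (α, -1 - z * α)) ∈ Γ := by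
  -- This is `Ã - z`, parametrized by `Γ`. It is onto because its range is closed (lower bound) and
  -- dense (trivial orthogonal complement).
  let T : Γ →L[ℂ] WithLp 2 (E × ℂ) :=
    { toFun := fun p => WithLp.toLp 2 (p.1.1.2 - z • p.1.1.1, -p.1.2.2 - z * p.1.2.1)
      map_add' := by
        intro p q
        refine congrArg (WithLp.toLp 2) (Prod.ext ?_ ?_)
        · simp; abel
        · simp; ring
      map_smul' := by
        intro c p
        refine congrArg (WithLp.toLp 2) (Prod.ext ?_ ?_)
        · simp [smul_sub, smul_comm c z]
        · simp; ring
      cont := by fun_prop }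
  have hT : ∀ (u : WithLp 2 (E × ℂ)) (p : Γ), inner ℂ u (T p) =
      inner ℂ u.fst p.1.1.2 - z * inner ℂ u.fst p.1.1.1
        + (-p.1.2.2 - z * p.1.2.1) * conj u.snd := by
    intro u p
    rw [← inner_smul_right, ← inner_sub_right]
    rfl
  have hΓ := isClosed_of_maximal hg hm
  have : CompleteSpace Γ := hΓ.completeSpace_coe
  -- Green's identity of `p` with itself says that the quadratic form of `Ã` is real, so only `z`
  -- contributes to the imaginary part of `⟨U, T p⟩`.
  have hbound : ∀ p : Γ, |z.im| * ‖WithLp.toLp 2 (p.1.1.1, p.1.2.1)‖ ≤ ‖T p‖ := by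
    intro p
    set U : WithLp 2 (E × ℂ) := WithLp.toLp 2 (p.1.1.1, p.1.2.1) with hU
    have hgr := hg _ p.2 _ p.2
    have h1 : inner ℂ U (T p) = inner ℂ p.1.1.1 p.1.1.2 - inner ℂ p.1.2.1 p.1.2.2
        - z * inner ℂ U U := by
      rw [hT, hU, WithLp.prod_inner_apply]
      simp only [RCLike.inner_apply, WithLp.toLp_fst, WithLp.toLp_snd]
      ring
    have h2 : (inner ℂ p.1.1.1 p.1.1.2 - inner ℂ p.1.2.1 p.1.2.2 : ℂ).im = 0 := by
      rw [← Complex.conj_eq_iff_im, map_sub, inner_conj_symm, inner_conj_symm]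
      unfold Green at hgr
      linear_combination -hgr
    have h3 : (inner ℂ U (T p)).im = - (z.im * ‖U‖ ^ 2) := by
      rw [h1, Complex.sub_im, h2, inner_self_eq_ofReal, Complex.im_mul_ofReal]
      ring
    have h4 : |z.im| * ‖U‖ ^ 2 ≤ ‖U‖ * ‖T p‖ := by
      calc |z.im| * ‖U‖ ^ 2 = |(inner ℂ U (T p)).im| := by
            rw [h3, abs_neg, abs_mul, abs_of_nonneg (sq_nonneg ‖U‖)]
        _ ≤ ‖inner ℂ U (T p)‖ := Complex.abs_im_le_norm _
        _ ≤ _ := norm_inner_le_norm _ _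
    rcases (norm_nonneg U).eq_or_lt with h | h
    · rw [← h]; simp
    · nlinarith
  -- The constant dominates all four components: `f` and `α` cost `1 / |Im z|`, while `g` and `β`
  -- cost `1 + ‖z‖ / |Im z|`.
  have hanti : AntilipschitzWith (Real.toNNReal ((1 + ‖z‖) / |z.im| + 1)) T := by
    refine T.antilipschitz_of_bound fun p => ?_
    have hz' : 0 < |z.im| := abs_pos.2 hz
    rw [Real.coe_toNNReal _ (by positivity)]
    have hU : ‖WithLp.toLp 2 (p.1.1.1, p.1.2.1)‖ ≤ ‖T p‖ / |z.im| := by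
      rw [le_div_iff₀ hz', mul_comm]; exact hbound p
    have hf : ‖p.1.1.1‖ ≤ ‖T p‖ / |z.im| := (WithLp.norm_fst_le (p := 2) _ _).trans hU
    have hα : ‖p.1.2.1‖ ≤ ‖T p‖ / |z.im| := (WithLp.norm_snd_le (p := 2) _ _).trans hU
    have e : ((1 + ‖z‖) / |z.im| + 1) * ‖T p‖
        = ‖T p‖ / |z.im| + ‖z‖ * (‖T p‖ / |z.im|) + ‖T p‖ := by ring
    have hnn : 0 ≤ ‖T p‖ / |z.im| := by positivity
    have hznn : 0 ≤ ‖z‖ * (‖T p‖ / |z.im|) := by positivity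
    have hg2 : ‖p.1.1.2‖ ≤ ‖T p‖ + ‖z‖ * (‖T p‖ / |z.im|) := by
      have h1 : ‖p.1.1.2 - z • p.1.1.1‖ ≤ ‖T p‖ := WithLp.norm_fst_le (p := 2) _ (T p)
      calc ‖p.1.1.2‖ = ‖(p.1.1.2 - z • p.1.1.1) + z • p.1.1.1‖ := by simp
        _ ≤ _ := norm_add_le _ _
        _ ≤ _ := by rw [norm_smul]; gcongr
    have hβ : ‖p.1.2.2‖ ≤ ‖T p‖ + ‖z‖ * (‖T p‖ / |z.im|) := by
      have h1 : ‖-p.1.2.2 - z * p.1.2.1‖ ≤ ‖T p‖ := WithLp.norm_snd_le (p := 2) _ (T p)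
      calc ‖p.1.2.2‖ = ‖-((-p.1.2.2 - z * p.1.2.1) + z * p.1.2.1)‖ := by simp
        _ = ‖(-p.1.2.2 - z * p.1.2.1) + z * p.1.2.1‖ := norm_neg _
        _ ≤ _ := norm_add_le _ _
        _ ≤ _ := by rw [norm_mul]; gcongr
    rw [e]
    have hT := norm_nonneg (T p)
    refine max_le (max_le ?_ ?_) (max_le ?_ ?_)
    · change ‖p.1.1.1‖ ≤ _; linarith
    · change ‖p.1.1.2‖ ≤ _; linarith
    · change ‖p.1.2.1‖ ≤ _; linarith
    · change ‖p.1.2.2‖ ≤ _; linarith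
  have hclosed : IsClosed (T.range : Set (WithLp 2 (E × ℂ))) := by
    rw [LinearMap.coe_range]
    exact hanti.isClosed_range T.uniformContinuous
  have hbot : (T.range)ᗮ = ⊥ := by
    rw [Submodule.eq_bot_iff]
    intro u hu
    rw [Submodule.mem_orthogonal'] at hu
    -- Orthogonality to the range is Green's identity with all of `Γ`, so maximality makes `u` an
    -- eigenvector of `Ã` at `conj z`. Green's identity with itself then kills it.
    have hmem : ((u.fst, conj z • u.fst), (u.snd, -(conj z * u.snd))) ∈ Γ := by
      refine hm _ fun p hp => ?_
      have := hu (T ⟨p, hp⟩) ⟨⟨p, hp⟩, rfl⟩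
      rw [hT] at this
      simp only [Green, inner_smul_left, RCLike.inner_apply, map_neg, map_mul,
        RCLike.conj_conj]
      linear_combination this
    have hgr := green_solutions hg hmem hmem
    have hzz : conj z - z ≠ 0 := by
      intro h
      exact hz (Complex.conj_eq_iff_im.1 (sub_eq_zero.1 h))
    have h0 : inner ℂ u u = 0 := by
      refine (mul_eq_zero.1 ?_).resolve_left hzz
      rw [WithLp.prod_inner_apply]
      change (conj z - z) * (inner ℂ u.fst u.fst + u.snd * conj u.snd) = 0
      simp only [map_neg, map_mul, RCLike.conj_conj] at hgr
      linear_combination hgr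
    exact inner_self_eq_zero.1 h0
  have htop : T.range = ⊤ := by
    have h := Submodule.orthogonal_orthogonal_eq_closure T.range
    rw [hclosed.submodule_topologicalClosure_eq, hbot, Submodule.bot_orthogonal_eq_top] at h
    exact h.symm
  obtain ⟨p, hp⟩ : WithLp.toLp 2 ((0 : E), (1 : ℂ)) ∈ T.range := htop ▸ Submodule.mem_top
  have h1 : p.1.1.2 - z • p.1.1.1 = 0 := congrArg WithLp.fst hp
  have h2 : -p.1.2.2 - z * p.1.2.1 = 1 := congrArg WithLp.snd hp
  refine ⟨p.1.1.1, p.1.2.1, ?_⟩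
  have h3 : -1 - z * p.1.2.1 = p.1.2.2 := by linear_combination h2
  rw [h3, ← sub_eq_zero.1 h1]
  exact p.2

end Solutions

/-- A family whose increments are controlled by those of a convergent function converges. -/
theorem exists_tendsto_of_norm_sub_sq_le {E : Type*} [NormedAddCommGroup E]
    [CompleteSpace E] {v : ℝ → E} {u : ℝ → ℝ} {c : ℝ}
    (hu : Tendsto u (𝓝[>] 0) (𝓝 c))
    (h : ∀ ε > 0, ∀ δ > 0, ‖v ε - v δ‖ ^ 2 ≤ |u ε - u δ|) :
    ∃ g, Tendsto v (𝓝[>] 0) (𝓝 g) := by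
  rw [← cauchy_map_iff_exists_tendsto, cauchy_map_iff', tendsto_uniformity_iff_dist_tendsto_zero]
  have hlim : Tendsto (fun p : ℝ × ℝ => √|u p.1 - u p.2|) (𝓝[>] 0 ×ˢ 𝓝[>] 0) (𝓝 0) := by
    have h1 := ((hu.comp tendsto_fst).sub (hu.comp tendsto_snd) :
      Tendsto _ (𝓝[>] (0 : ℝ) ×ˢ 𝓝[>] (0 : ℝ)) _)
    have h2 := (Real.continuous_sqrt.comp continuous_abs).tendsto (c - c) |>.comp h1
    simpa [Function.comp_def] using h2
  refine squeeze_zero' (Eventually.of_forall fun _ => dist_nonneg) ?_ hlim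
  have hpos : ∀ᶠ ε : ℝ in 𝓝[>] 0, 0 < ε := self_mem_nhdsWithin
  filter_upwards [hpos.prod_mk hpos] with p hp
  rw [dist_eq_norm]
  exact Real.le_sqrt_of_sq_le (h _ hp.1 _ hp.2)

/-! ### Weyl solutions along the normal to the real axis -/

section Weyl

variable {E : Type*} [NormedAddCommGroup E] [InnerProductSpace ℂ E]
variable {Γ : Submodule ℂ ((E × E) × (ℂ × ℂ))}

/-- Rescale the solution from `exists_resolvent_mem`. Its first boundary value is nonzero: otherwise
Green's identity gives `f = 0`, and `(0; -1)` in `mul Γ` contradicts function type. -/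
theorem exists_weyl_solution [CompleteSpace E] (hg : ∀ p ∈ Γ, ∀ q ∈ Γ, Green p q)
    (hm : ∀ q, (∀ p ∈ Γ, Green p q) → q ∈ Γ) (hfun : IsFunctionType Γ) {z : ℂ} (hz : z.im ≠ 0) :
    ∃ f, ((f, z • f), ((1 : ℂ), weylFunction Γ z)) ∈ Γ := by
  suffices h : ∃ β : ℂ, ((1 : ℂ), β) ∈ weylFamily Γ z from Classical.epsilon_spec h
  obtain ⟨f, α, hf⟩ := exists_resolvent_mem hg hm hz
  have hα : α ≠ 0 := by
    rintro rfl
    have h := green_solutions hg hf hf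
    have hzz : z - conj z ≠ 0 := fun h => hz (Complex.conj_eq_iff_im.1 (sub_eq_zero.1 h).symm)
    have hf0 : f = 0 := by
      refine inner_self_eq_zero.1 ((mul_eq_zero.1 ?_).resolve_left hzz)
      simpa using h
    rw [hf0] at hf
    have := hfun (-1 - z * 0) (by simpa using hf)
    simp at this
  refine ⟨α⁻¹ * (-1 - z * α), α⁻¹ • f, ?_⟩
  have := Γ.smul_mem α⁻¹ hf
  rw [Prod.smul_mk, Prod.smul_mk, Prod.smul_mk, smul_comm, smul_eq_mul, smul_eq_mul,
    inv_mul_cancel₀ hα] at this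
  exact this

variable {x : ℝ} {γ : ℝ → E} {m : ℝ → ℂ}

section Normal

variable (hg : ∀ p ∈ Γ, ∀ q ∈ Γ, Green p q)
  (hγ : ∀ ε : ℝ, 0 < ε → ((γ ε, ((x : ℂ) + Complex.I * ε) • γ ε), ((1 : ℂ), m ε)) ∈ Γ)

include hg hγ

theorem green_normal {ε δ : ℝ} (hε : 0 < ε) (hδ : 0 < δ) :
    Complex.I * (ε + δ) * inner ℂ (γ δ) (γ ε) = m ε - conj (m δ) := by
  have := green_solutions hg (hγ ε hε) (hγ δ hδ)
  simp only [map_add, map_mul, Complex.conj_ofReal, Complex.conj_I, map_one] at this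
  linear_combination this

theorem im_eq_mul_norm_sq {ε : ℝ} (hε : 0 < ε) : (m ε).im = ε * ‖γ ε‖ ^ 2 := by
  have := congrArg Complex.im (green_normal hg hγ hε hε)
  rw [inner_self_eq_ofReal, Complex.im_mul_ofReal] at this
  simp at this
  linarith

theorem add_mul_re_inner {ε δ : ℝ} (hε : 0 < ε) (hδ : 0 < δ) :
    (ε + δ) * (inner ℂ (γ δ) (γ ε)).re = ε * ‖γ ε‖ ^ 2 + δ * ‖γ δ‖ ^ 2 := by
  have := congrArg Complex.im (green_normal hg hγ hε hδ)
  rw [Complex.sub_im, Complex.conj_im, im_eq_mul_norm_sq hg hγ hε,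
    im_eq_mul_norm_sq hg hγ hδ] at this
  simp at this
  linarith

/-- Expand the square; `add_mul_re_inner` expresses the cross term by the two norms. The sign of the
right side makes `‖γ ε‖` decreasing in `ε`. -/
theorem add_mul_norm_sub_sq {ε δ : ℝ} (hε : 0 < ε) (hδ : 0 < δ) :
    (ε + δ) * ‖γ ε - γ δ‖ ^ 2 = (δ - ε) * (‖γ ε‖ ^ 2 - ‖γ δ‖ ^ 2) := by
  have h := add_mul_re_inner hg hγ hε hδ
  have h2 := norm_sub_sq (𝕜 := ℂ) (γ δ) (γ ε)
  rw [norm_sub_rev, h2]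
  simp only [RCLike.re_to_complex]
  linear_combination -2 * h

theorem add_mul_norm_smul_sub_sq {ε δ : ℝ} (hε : 0 < ε) (hδ : 0 < δ) :
    (ε + δ) * ‖(ε : ℂ) • γ ε - (δ : ℂ) • γ δ‖ ^ 2
      = (ε - δ) * (ε ^ 2 * ‖γ ε‖ ^ 2 - δ ^ 2 * ‖γ δ‖ ^ 2) := by
  have h := add_mul_re_inner hg hγ hε hδ
  have h2 := norm_sub_sq (𝕜 := ℂ) ((δ : ℂ) • γ δ) ((ε : ℂ) • γ ε)
  rw [norm_sub_rev, h2, inner_smul_left, inner_smul_right, norm_smul, norm_smul, Complex.norm_real,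
    Complex.norm_real, Real.norm_of_nonneg hε.le, Real.norm_of_nonneg hδ.le]
  simp only [RCLike.re_to_complex, Complex.conj_ofReal, Complex.re_ofReal_mul]
  linear_combination -2 * ε * δ * h

/-- Since `|δ - ε| ≤ ε + δ`, the identity above bounds `‖γ ε - γ δ‖²` by the increment of the
squared norm. -/
theorem exists_tendsto_solution_of_tendsto_norm_sq [CompleteSpace E] {c : ℝ}
    (hlim : Tendsto (fun ε => ‖γ ε‖ ^ 2) (𝓝[>] 0) (𝓝 c)) :
    ∃ g, Tendsto γ (𝓝[>] 0) (𝓝 g) := by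
  refine exists_tendsto_of_norm_sub_sq_le hlim fun ε hε δ hδ => ?_
  have h := add_mul_norm_sub_sq hg hγ hε hδ
  have hpos : 0 < ε + δ := add_pos hε hδ
  refine le_of_mul_le_mul_left ?_ hpos
  rw [h]
  calc _ ≤ |(δ - ε) * (‖γ ε‖ ^ 2 - ‖γ δ‖ ^ 2)| := le_abs_self _
    _ = |δ - ε| * |‖γ ε‖ ^ 2 - ‖γ δ‖ ^ 2| := abs_mul _ _
    _ ≤ _ := by
      gcongr
      rw [abs_le]
      constructor <;> linarith

/-- If the solutions are bounded near the real axis, they converge. -/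
theorem exists_tendsto_solution [CompleteSpace E] {C : ℝ} (hC : ∀ ε : ℝ, 0 < ε → ‖γ ε‖ ≤ C) :
    ∃ g, Tendsto γ (𝓝[>] 0) (𝓝 g) := by
  have hanti : AntitoneOn (fun ε => ‖γ ε‖ ^ 2) (Set.Ioi 0) := by
    intro ε hε δ hδ hle
    rcases hle.eq_or_lt with rfl | hlt
    · exact le_rfl
    have hε' : 0 < ε := hε
    have hδ' : 0 < δ := hδ
    have h := add_mul_norm_sub_sq hg hγ hε' hδ'
    have h1 : 0 ≤ (δ - ε) * (‖γ ε‖ ^ 2 - ‖γ δ‖ ^ 2) := by rw [← h]; positivity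
    have := nonneg_of_mul_nonneg_right h1 (sub_pos.2 hlt)
    simp only
    linarith
  have hlim := hanti.tendsto_nhdsGT ⟨C ^ 2, by
    rintro _ ⟨ε, hε, rfl⟩
    exact pow_le_pow_left₀ (norm_nonneg _) (hC ε hε) 2⟩
  exact exists_tendsto_solution_of_tendsto_norm_sq hg hγ hlim

theorem mem_of_tendsto_solution (hm : ∀ q, (∀ p ∈ Γ, Green p q) → q ∈ Γ) {g : E} {β : ℂ}
    (h1 : Tendsto γ (𝓝[>] 0) (𝓝 g)) (h2 : Tendsto m (𝓝[>] 0) (𝓝 β)) :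
    ((g, (x : ℂ) • g), ((1 : ℂ), β)) ∈ Γ := by
  have hz : Tendsto (fun ε : ℝ => (x : ℂ) + Complex.I * ε) (𝓝[>] 0) (𝓝 x) := by
    have : Continuous fun ε : ℝ => (x : ℂ) + Complex.I * ε := by fun_prop
    simpa using (this.tendsto 0).mono_left nhdsWithin_le_nhds
  refine (isClosed_of_maximal hg hm).mem_of_tendsto
    ((h1.prodMk_nhds (hz.smul h1)).prodMk_nhds (tendsto_const_nhds.prodMk_nhds h2)) ?_
  filter_upwards [self_mem_nhdsWithin] with ε hε using hγ ε hε

/-- The vectors `ε γ(x + iε)` always converge to a solution at `x` with vanishing first boundary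
value. -/
theorem exists_tendsto_smul_solution [CompleteSpace E]
    (hm : ∀ q, (∀ p ∈ Γ, Green p q) → q ∈ Γ) :
    ∃ h μ, Tendsto (fun ε : ℝ => (ε : ℂ) • γ ε) (𝓝[>] 0) (𝓝 h) ∧
      ((h, (x : ℂ) • h), ((0 : ℂ), μ)) ∈ Γ ∧
      Tendsto (fun ε : ℝ => ε * (m ε).im) (𝓝[>] 0) (𝓝 (‖h‖ ^ 2)) := by
  have hmono : MonotoneOn (fun ε => ε ^ 2 * ‖γ ε‖ ^ 2) (Set.Ioi 0) := by
    intro ε hε δ hδ hle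
    rcases hle.eq_or_lt with rfl | hlt
    · exact le_rfl
    have hε' : 0 < ε := hε
    have hδ' : 0 < δ := hδ
    have h := add_mul_norm_smul_sub_sq hg hγ hδ' hε'
    have h1 : 0 ≤ (δ - ε) * (δ ^ 2 * ‖γ δ‖ ^ 2 - ε ^ 2 * ‖γ ε‖ ^ 2) := by rw [← h]; positivity
    have := nonneg_of_mul_nonneg_right h1 (sub_pos.2 hlt)
    simp only
    linarith
  have hlim := hmono.tendsto_nhdsGT ⟨0, by
    rintro _ ⟨ε, hε, rfl⟩
    simp only
    positivity⟩
  obtain ⟨h, hh⟩ : ∃ h, Tendsto (fun ε : ℝ => (ε : ℂ) • γ ε) (𝓝[>] 0) (𝓝 h) := by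
    refine exists_tendsto_of_norm_sub_sq_le hlim fun ε hε δ hδ => ?_
    have h := add_mul_norm_smul_sub_sq hg hγ hε hδ
    have hpos : 0 < ε + δ := add_pos hε hδ
    refine le_of_mul_le_mul_left ?_ hpos
    rw [h]
    calc _ ≤ |(ε - δ) * (ε ^ 2 * ‖γ ε‖ ^ 2 - δ ^ 2 * ‖γ δ‖ ^ 2)| := le_abs_self _
      _ = |ε - δ| * |ε ^ 2 * ‖γ ε‖ ^ 2 - δ ^ 2 * ‖γ δ‖ ^ 2| := abs_mul _ _
      _ ≤ _ := by
        gcongr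
        rw [abs_le]
        constructor <;> linarith [hε.lt, hδ.lt]
  have hofReal : Tendsto (fun ε : ℝ => (ε : ℂ)) (𝓝[>] 0) (𝓝 0) := by
    simpa using (Complex.continuous_ofReal.tendsto 0).mono_left nhdsWithin_le_nhds
  have hz : Tendsto (fun ε : ℝ => (x : ℂ) + Complex.I * ε) (𝓝[>] 0) (𝓝 x) := by
    simpa using tendsto_const_nhds.add (hofReal.const_mul Complex.I)
  -- Green's identity with the fixed solution at `δ = 1` expresses `ε m ε` through `ε γ ε`, which
  -- converges.
  obtain ⟨μ, hμ⟩ : ∃ μ, Tendsto (fun ε : ℝ => (ε : ℂ) * m ε) (𝓝[>] 0) (𝓝 μ) := by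
    have h1 : Tendsto (fun ε : ℝ => Complex.I * ((ε : ℂ) + (1 : ℝ)) *
        inner ℂ (γ 1) ((ε : ℂ) • γ ε) + ε * conj (m 1)) (𝓝[>] 0) (𝓝 _) :=
      (((hofReal.add tendsto_const_nhds).const_mul Complex.I).mul
        (tendsto_const_nhds.inner hh)).add (hofReal.mul_const _)
    refine ⟨_, h1.congr' ?_⟩
    filter_upwards [self_mem_nhdsWithin] with ε hε
    rw [inner_smul_right]
    linear_combination (ε : ℂ) * green_normal hg hγ hε one_pos
  refine ⟨h, μ, hh, ?_, ?_⟩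
  · refine (isClosed_of_maximal hg hm).mem_of_tendsto
      ((hh.prodMk_nhds (hz.smul hh)).prodMk_nhds (hofReal.prodMk_nhds hμ)) ?_
    filter_upwards [self_mem_nhdsWithin] with ε hε
    have := Γ.smul_mem (ε : ℂ) (hγ ε hε)
    rw [Prod.smul_mk, Prod.smul_mk, Prod.smul_mk, smul_comm, smul_eq_mul, smul_eq_mul,
      mul_one] at this
    exact this
  · refine (hh.norm.pow 2).congr' ?_
    filter_upwards [self_mem_nhdsWithin] with ε hε
    have hε' : 0 < ε := hε
    rw [im_eq_mul_norm_sq hg hγ hε, norm_smul, Complex.norm_real, Real.norm_of_nonneg hε'.le]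
    ring

end Normal

end Weyl

/-! ### Solutions at a real point and normal limits of the Weyl function -/

section RealPoint

variable {E : Type*} [NormedAddCommGroup E] [InnerProductSpace ℂ E]
variable {S : Submodule ℂ (E × E)} {Γ : Submodule ℂ ((E × E) × (ℂ × ℂ))} {x : ℝ}

/-- A solution at a real point is determined by its boundary values. -/
theorem IsBoundaryRelation.eq_zero_of_mem [CompleteSpace E] (hΓ : IsBoundaryRelation S Γ)
    (hclosed : IsClosed (S : Set (E × E))) (hsymm : IsSymmetricRel S) (hsimple : IsSimpleRel S)
    {f : E} (hf : ((f, (x : ℂ) • f), ((0 : ℂ), (0 : ℂ))) ∈ Γ) : f = 0 := by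
  -- With zero boundary values, Green's identity puts `(f; x f)` in the adjoint of the domain of
  -- `Γ`. By density that is `S**`, which lies in `S`.
  refine hsimple.eq_zero_of_mem hsymm (x := x) (mem_of_forall_mem_adjoint hclosed fun q hq => ?_)
  have hcl : IsClosed {q : E × E | inner ℂ q.2 f - inner ℂ q.1 ((x : ℂ) • f) = 0} :=
    isClosed_eq (by fun_prop) continuous_const
  refine closure_minimal ?_ hcl (hΓ.dom_dense hq)
  rintro _ ⟨p, hp, rfl⟩
  have := hΓ.green _ hf _ hp
  simp only [Green, inner_zero_right, sub_self] at this
  change inner ℂ p.1.2 f - inner ℂ p.1.1 ((x : ℂ) • f) = 0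
  linear_combination -this

theorem mem_pointSpectrum_kerPi₁_iff :
    (x : ℂ) ∈ pointSpectrum (kerPi₁ Γ) ↔
      ∃ f β, f ≠ 0 ∧ ((f, (x : ℂ) • f), ((0 : ℂ), β)) ∈ Γ := by
  change eigenspace (kerPi₁ Γ) x ≠ ⊥ ↔ _
  rw [Submodule.ne_bot_iff]
  constructor
  · rintro ⟨f, ⟨β, hβ⟩, hf⟩
    exact ⟨f, β, hf, hβ⟩
  · rintro ⟨f, β, hf, hβ⟩
    exact ⟨f, ⟨β, hβ⟩, hf⟩

theorem exists_normal_solutions [CompleteSpace E] (hg : ∀ p ∈ Γ, ∀ q ∈ Γ, Green p q)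
    (hm : ∀ q, (∀ p ∈ Γ, Green p q) → q ∈ Γ) (hfun : IsFunctionType Γ) (x : ℝ) :
    ∃ γ : ℝ → E, ∀ ε : ℝ, 0 < ε → ((γ ε, ((x : ℂ) + Complex.I * ε) • γ ε),
      ((1 : ℂ), weylFunction Γ (x + Complex.I * ε))) ∈ Γ := by
  have hsol : ∀ ε : ℝ, ∃ f, 0 < ε → ((f, ((x : ℂ) + Complex.I * ε) • f),
      ((1 : ℂ), weylFunction Γ (x + Complex.I * ε))) ∈ Γ := by
    intro ε
    by_cases hε : 0 < ε
    · obtain ⟨f, hf⟩ := exists_weyl_solution hg hm hfun (z := x + Complex.I * ε)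
        (by simpa using hε.ne')
      exact ⟨f, fun _ => hf⟩
    · exact ⟨0, fun h => absurd h hε⟩
  choose γ hγ using hsol
  exact ⟨γ, hγ⟩

section Kernel

variable (hg : ∀ p ∈ Γ, ∀ q ∈ Γ, Green p q)
  (hker : ∀ f, ((f, (x : ℂ) • f), ((0 : ℂ), (0 : ℂ))) ∈ Γ → f = 0)

include hker

theorem exists_mem_of_mem_pointSpectrum (hx : (x : ℂ) ∈ pointSpectrum (kerPi₁ Γ)) :
    ∃ f, ((f, (x : ℂ) • f), ((0 : ℂ), (1 : ℂ))) ∈ Γ := by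
  obtain ⟨f, β, hf, hfβ⟩ := mem_pointSpectrum_kerPi₁_iff.1 hx
  have hβ : β ≠ 0 := by
    rintro rfl
    exact hf (hker f hfβ)
  refine ⟨β⁻¹ • f, ?_⟩
  have := Γ.smul_mem β⁻¹ hfβ
  rwa [Prod.smul_mk, Prod.smul_mk, Prod.smul_mk, smul_comm, smul_zero, smul_eq_mul,
    inv_mul_cancel₀ hβ] at this

include hg

/-- At an eigenvalue of `ker (π₁ ∘ Γ)` the first boundary value of every solution vanishes. -/
theorem boundary_fst_eq_zero (hx : (x : ℂ) ∈ pointSpectrum (kerPi₁ Γ)) {g : E} {α β : ℂ}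
    (h : ((g, (x : ℂ) • g), (α, β)) ∈ Γ) : α = 0 := by
  obtain ⟨f, hf⟩ := exists_mem_of_mem_pointSpectrum hker hx
  have := green_solutions hg h hf
  simpa using this.symm

variable [CompleteSpace E] (hm : ∀ q, (∀ p ∈ Γ, Green p q) → q ∈ Γ) (hfun : IsFunctionType Γ)

include hm hfun

/-- The limit of `ε Im m` is `‖h‖²`, where `h` is the limit of `ε γ ε` and has first boundary value
`0`; the question is whether `h` vanishes. -/
theorem mem_pointSpectrum_kerPi₁_iff_tendsto :
    (x : ℂ) ∈ pointSpectrum (kerPi₁ Γ) ↔ ∃ c : ℝ, 0 < c ∧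
      Tendsto (fun ε : ℝ => ε * (weylFunction Γ (x + Complex.I * ε)).im) (𝓝[>] 0) (𝓝 c) := by
  obtain ⟨γ, hγ⟩ := exists_normal_solutions hg hm hfun x
  obtain ⟨h, μ, hh, hmem, hlim⟩ := exists_tendsto_smul_solution hg hγ hm
  constructor
  · intro hx
    refine ⟨‖h‖ ^ 2, ?_, hlim⟩
    obtain ⟨f, hf⟩ := exists_mem_of_mem_pointSpectrum hker hx
    -- Green's identity with the eigenvector `f`, normalized to boundary values `(0; 1)`, gives `⟨f,
    -- ε γ ε⟩ = i` for every `ε`.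
    have hne : h ≠ 0 := by
      rintro rfl
      have h1 : Tendsto (fun ε : ℝ => inner ℂ f ((ε : ℂ) • γ ε)) (𝓝[>] 0) (𝓝 0) := by
        rw [← inner_zero_right (𝕜 := ℂ) f]
        exact tendsto_const_nhds.inner hh
      have h2 : Tendsto (fun ε : ℝ => inner ℂ f ((ε : ℂ) • γ ε)) (𝓝[>] 0) (𝓝 Complex.I) := by
        refine tendsto_const_nhds.congr' ?_
        filter_upwards [self_mem_nhdsWithin] with ε hε
        have h3 := green_solutions hg (hγ ε hε) hf
        simp only [Complex.conj_ofReal, map_zero, map_one] at h3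
        rw [inner_smul_right]
        linear_combination Complex.I * h3 - (ε : ℂ) * inner ℂ f (γ ε) * Complex.I_mul_I
      exact Complex.I_ne_zero (tendsto_nhds_unique h2 h1)
    positivity
  · rintro ⟨c, hc, hlim'⟩
    refine mem_pointSpectrum_kerPi₁_iff.2 ⟨h, μ, ?_, hmem⟩
    rintro rfl
    have := tendsto_nhds_unique hlim hlim'
    simp at this
    exact hc.ne this

/-- Real points admitting a solution with first boundary value `1`, in terms of the Weyl
function. -/
theorem exists_solution_iff (β : ℝ) :
    (∃ f, ((f, (x : ℂ) • f), ((1 : ℂ), (β : ℂ))) ∈ Γ) ↔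
      Tendsto (fun ε : ℝ => weylFunction Γ (x + Complex.I * ε)) (𝓝[>] 0) (𝓝 (β : ℂ)) ∧
      ∃ d : ℝ, 0 ≤ d ∧ Tendsto (fun ε : ℝ => 1 / (Complex.I * ε) *
        (weylFunction Γ (x + Complex.I * ε) - β)) (𝓝[>] 0) (𝓝 (d : ℂ)) := by
  obtain ⟨γ, hγ⟩ := exists_normal_solutions hg hm hfun x
  have hofReal : Tendsto (fun ε : ℝ => (ε : ℂ)) (𝓝[>] 0) (𝓝 0) := by
    simpa using (Complex.continuous_ofReal.tendsto 0).mono_left nhdsWithin_le_nhds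
  constructor
  · rintro ⟨f, hf⟩
    have hgr : ∀ ε : ℝ, 0 < ε → weylFunction Γ (x + Complex.I * ε)
        = β + Complex.I * ε * inner ℂ f (γ ε) := by
      intro ε hε
      have h := green_solutions hg (hγ ε hε) hf
      simp only [Complex.conj_ofReal, map_one] at h
      linear_combination -h
    -- The imaginary part of `hgr` reads `‖γ ε‖² = Re ⟨f, γ ε⟩`; apply Cauchy-Schwarz.
    have hbound : ∀ ε : ℝ, 0 < ε → ‖γ ε‖ ≤ ‖f‖ := by
      intro ε hε
      have h1 := im_eq_mul_norm_sq hg hγ hε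
      rw [hgr ε hε] at h1
      simp at h1
      have h2 : ‖γ ε‖ ^ 2 ≤ ‖f‖ * ‖γ ε‖ := by
        rw [← h1.resolve_right hε.ne']
        exact (Complex.re_le_norm _).trans (norm_inner_le_norm _ _)
      rcases (norm_nonneg (γ ε)).eq_or_lt with h | h
      · rw [← h]; exact norm_nonneg f
      · nlinarith
    obtain ⟨g, hgl⟩ := exists_tendsto_solution hg hγ hbound
    have hinner : Tendsto (fun ε => inner ℂ f (γ ε)) (𝓝[>] 0) (𝓝 (inner ℂ f g)) :=
      tendsto_const_nhds.inner hgl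
    have hml : Tendsto (fun ε : ℝ => weylFunction Γ (x + Complex.I * ε)) (𝓝[>] 0)
        (𝓝 (β : ℂ)) := by
      have h1 : Tendsto (fun ε : ℝ => (β : ℂ) + Complex.I * ε * inner ℂ f (γ ε)) (𝓝[>] 0)
          (𝓝 (β + Complex.I * 0 * inner ℂ f g)) :=
        tendsto_const_nhds.add ((hofReal.const_mul _).mul hinner)
      simp only [mul_zero, zero_mul, add_zero] at h1
      refine h1.congr' ?_
      filter_upwards [self_mem_nhdsWithin] with ε hε using (hgr ε hε).symm
    refine ⟨hml, ‖f‖ ^ 2, by positivity, ?_⟩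
    -- Both are solutions at `x` with boundary values `(1; β)`.
    have hgf : g = f := by
      refine sub_eq_zero.1 (hker _ ?_)
      have := Γ.sub_mem (mem_of_tendsto_solution hg hγ hm hgl hml) hf
      rwa [Prod.mk_sub_mk, Prod.mk_sub_mk, Prod.mk_sub_mk, ← smul_sub, sub_self, sub_self] at this
    rw [← inner_self_eq_ofReal]
    nth_rewrite 2 [← hgf]
    refine hinner.congr' ?_
    filter_upwards [self_mem_nhdsWithin] with ε hε
    have hε' : (ε : ℂ) ≠ 0 := Complex.ofReal_ne_zero.2 (ne_of_gt hε)
    rw [hgr ε hε]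
    field_simp [Complex.I_ne_zero]
    ring
  · rintro ⟨hml, d, -, hd⟩
    -- As `β` is real, the real part of the difference quotient is `Im m / ε = ‖γ ε‖²`.
    have hnorm : Tendsto (fun ε : ℝ => ‖γ ε‖ ^ 2) (𝓝[>] 0) (𝓝 d) := by
      have h1 := (Complex.continuous_re.tendsto _).comp hd
      rw [Complex.ofReal_re] at h1
      refine h1.congr' ?_
      filter_upwards [self_mem_nhdsWithin] with ε hε
      have hε' : ε ≠ 0 := ne_of_gt hε
      have h2 := im_eq_mul_norm_sq hg hγ hε
      have h3 : 1 / (Complex.I * ε) = ((ε⁻¹ : ℝ) : ℂ) * (-Complex.I) := by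
        rw [one_div, mul_inv, Complex.inv_I, Complex.ofReal_inv, mul_comm]
      rw [Function.comp_apply, h3, mul_assoc, Complex.re_ofReal_mul]
      simp [h2]
      field_simp
    obtain ⟨g, hgl⟩ := exists_tendsto_solution_of_tendsto_norm_sq hg hγ hnorm
    exact ⟨g, mem_of_tendsto_solution hg hγ hm hgl hml⟩

end Kernel

end RealPoint

/-! ### Eigenvectors of the pasting and their multiplicity -/

section Paste

variable {n : ℕ} {H : Fin n → Type*} [∀ l, NormedAddCommGroup (H l)]
  [∀ l, InnerProductSpace ℂ (H l)] {Γ : ∀ l, Submodule ℂ ((H l × H l) × (ℂ × ℂ))} {x : ℝ}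

theorem pasteFst_eq_zero_iff (hn : 2 ≤ n) (α β : Fin n → ℂ) :
    pasteFst hn α β = 0 ↔ (∀ l, α l = α (lastIdx hn)) ∧ ∑ k, β k = 0 := by
  constructor
  · intro h
    have hl : ∀ l, (if l = lastIdx hn then ∑ k, β k else -α l + α (lastIdx hn)) = 0 :=
      fun l => congrArg (fun v : EuclideanSpace ℂ (Fin n) => v l) h
    refine ⟨fun l => ?_, by simpa using hl (lastIdx hn)⟩
    by_cases hll : l = lastIdx hn
    · rw [hll]
    · have := hl l
      rw [if_neg hll] at this
      linear_combination -this
  · rintro ⟨h1, h2⟩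
    ext l
    by_cases hll : l = lastIdx hn
    · simp [pasteFst, hll, h2]
    · simp [pasteFst, hll, h1 l]

/-- Eigenvectors of the pasting: the first boundary values agree and the second ones sum to
zero. -/
theorem mem_eigenspace_pasting_iff (hn : 2 ≤ n) {z : ℂ} {u : PiLp 2 H} :
    u ∈ eigenspace (pasting hn Γ) z ↔
      ∃ (a : ℂ) (β : Fin n → ℂ), (∀ l, ((u l, z • u l), (a, β l)) ∈ Γ l) ∧ ∑ l, β l = 0 := by
  rw [mem_eigenspace]
  constructor
  · rintro ⟨b, α, β, h, hb⟩
    obtain ⟨h1, h2⟩ := (pasteFst_eq_zero_iff hn α β).1 (congrArg Prod.fst hb).symm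
    exact ⟨α (lastIdx hn), β, fun l => h1 l ▸ h l, h2⟩
  · rintro ⟨a, β, h, hβ⟩
    refine ⟨pasteSnd hn (fun _ => a) β, fun _ => a, β, h, ?_⟩
    rw [(pasteFst_eq_zero_iff hn (fun _ => a) β).2 ⟨fun _ => rfl, hβ⟩]

section Multiplicity

variable (hg : ∀ l, ∀ p ∈ Γ l, ∀ q ∈ Γ l, Green p q)
  (hker : ∀ l f, ((f, (x : ℂ) • f), ((0 : ℂ), (0 : ℂ))) ∈ Γ l → f = 0)

include hg hker

/-- With `e l` the eigenvector of boundary values `(0; 1)`, the eigenspace consists of the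
combinations of the `e l`, `l ∈ s`, with coefficients summing to zero. It has codimension one in
`ℂ^s`; for `s` a singleton it is trivial. -/
theorem eigenMultiplicity_pasting_of_mem (hn : 2 ≤ n) (hfun : ∀ l, IsFunctionType (Γ l))
    (s : Finset (Fin n)) (hs : ∀ l, l ∈ s ↔ (x : ℂ) ∈ pointSpectrum (kerPi₁ (Γ l)))
    (hne : s.Nonempty) :
    eigenMultiplicity (pasting hn Γ) x = ((s.card - 1 : ℕ) : Cardinal) := by
  have he : ∀ l, ∃ e : H l, l ∈ s → ((e, (x : ℂ) • e), ((0 : ℂ), (1 : ℂ))) ∈ Γ l := by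
    intro l
    by_cases hl : l ∈ s
    · obtain ⟨e, he⟩ := exists_mem_of_mem_pointSpectrum (hker l) ((hs l).1 hl)
      exact ⟨e, fun _ => he⟩
    · exact ⟨0, fun h => absurd h hl⟩
  choose e he using he
  have he0 : ∀ l ∈ s, e l ≠ 0 := by
    intro l hl h0
    have := he l hl
    rw [h0, smul_zero] at this
    exact one_ne_zero (hfun l 1 this)
  let Φ : (s → ℂ) →ₗ[ℂ] PiLp 2 H :=
    { toFun := fun c => WithLp.toLp 2 fun l => if h : l ∈ s then c ⟨l, h⟩ • e l else 0
      map_add' := by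
        intro c d
        ext l
        by_cases h : l ∈ s <;> simp [h, add_smul]
      map_smul' := by
        intro r c
        ext l
        by_cases h : l ∈ s <;> simp [h, mul_smul] }
  have hΦmem : ∀ (c : s → ℂ) (l) (h : l ∈ s), Φ c l = c ⟨l, h⟩ • e l := by
    intro c l h
    simp [Φ, h]
  have hΦnot : ∀ (c : s → ℂ) (l), l ∉ s → Φ c l = 0 := by
    intro c l h
    simp [Φ, h]
  have hinj : Function.Injective Φ := by
    refine (injective_iff_map_eq_zero Φ).2 fun c hc => funext fun l => ?_
    have h1 := hΦmem c l l.2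
    rw [hc] at h1
    exact (smul_eq_zero.1 h1.symm).resolve_right (he0 l l.2)
  let σ : Module.Dual ℂ (s → ℂ) := ∑ i, LinearMap.proj i
  have hσ : ∀ c, σ c = ∑ i, c i := by
    intro c
    simp [σ]
  have hmap : eigenspace (pasting hn Γ) x = (LinearMap.ker σ).map Φ := by
    ext u
    rw [mem_eigenspace_pasting_iff, Submodule.mem_map]
    constructor
    · rintro ⟨a, β, hu, hβ⟩
      obtain ⟨l₀, hl₀⟩ := hne
      obtain rfl : a = 0 := boundary_fst_eq_zero (hg l₀) (hker l₀) ((hs l₀).1 hl₀) (hu l₀)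
      have hu0 : ∀ l ∉ s, u l = 0 := by
        intro l hl
        by_contra h
        exact hl ((hs l).2 (mem_pointSpectrum_kerPi₁_iff.2 ⟨u l, β l, h, hu l⟩))
      -- Function type is what prevents a zero component from contributing to the sum.
      have hβ0 : ∀ l ∉ s, β l = 0 := by
        intro l hl
        have := hu l
        rw [hu0 l hl, smul_zero] at this
        exact hfun l _ this
      refine ⟨fun i => β i, ?_, ?_⟩
      · rw [LinearMap.mem_ker, hσ, Finset.sum_coe_sort s β, ← hβ]
        exact Finset.sum_subset (Finset.subset_univ s) fun l _ hl => hβ0 l hl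
      · ext l
        by_cases hl : l ∈ s
        · rw [hΦmem _ l hl]
          refine (sub_eq_zero.1 (hker l _ ?_)).symm
          have := (Γ l).sub_mem (hu l) ((Γ l).smul_mem (β l) (he l hl))
          simpa only [Prod.smul_mk, Prod.mk_sub_mk, smul_comm (β l), ← smul_sub, smul_eq_mul,
            mul_one, mul_zero, sub_self, Prod.mk_zero_zero] using this
        · rw [hΦnot _ l hl, hu0 l hl]
    · rintro ⟨c, hc, rfl⟩
      rw [LinearMap.mem_ker, hσ] at hc
      set β : Fin n → ℂ := fun l => if h : l ∈ s then c ⟨l, h⟩ else 0 with hβ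
      have hβs : ∀ i : s, β i = c i := by
        intro i
        simp [hβ]
      refine ⟨0, β, fun l => ?_, ?_⟩
      · by_cases hl : l ∈ s
        · rw [hΦmem c l hl]
          have := (Γ l).smul_mem (c ⟨l, hl⟩) (he l hl)
          have hβl : β l = c ⟨l, hl⟩ := hβs ⟨l, hl⟩
          rw [hβl]
          simpa only [Prod.smul_mk, smul_comm (c ⟨l, hl⟩), smul_zero, smul_eq_mul,
            mul_one, mul_zero] using this
        · rw [hΦnot c l hl, smul_zero]
          have : β l = 0 := by simp [hβ, hl]
          rw [this]
          exact (Γ l).zero_mem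
      · rw [← hc, ← Finset.sum_congr rfl fun i _ => hβs i, Finset.sum_coe_sort s β]
        refine (Finset.sum_subset (Finset.subset_univ s) fun l _ hl => ?_).symm
        simp [hβ, hl]
  have hσ0 : σ ≠ 0 := by
    obtain ⟨l₀, hl₀⟩ := hne
    intro h
    have := hσ (Pi.single ⟨l₀, hl₀⟩ 1)
    rw [h] at this
    simp at this
  have hrank := Module.Dual.finrank_ker_add_one_of_ne_zero hσ0
  rw [Module.finrank_fintype_fun_eq_card, Fintype.card_coe] at hrank
  unfold eigenMultiplicity
  rw [hmap, ← Module.finrank_eq_rank,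
    ← ((LinearMap.ker σ).equivMapOfInjective Φ hinj).finrank_eq, ← hrank, Nat.add_sub_cancel]

theorem two_le_card_or_exists_of_mem_pointSpectrum (hn : 2 ≤ n)
    (s : Finset (Fin n)) (hs : ∀ l, l ∈ s ↔ (x : ℂ) ∈ pointSpectrum (kerPi₁ (Γ l)))
    (hfun : ∀ l, IsFunctionType (Γ l)) (hx : (x : ℂ) ∈ pointSpectrum (pasting hn Γ)) :
    2 ≤ s.card ∨ ∃ (u : ∀ l, H l) (β : Fin n → ℂ),
      (∀ l, ((u l, (x : ℂ) • u l), ((1 : ℂ), β l)) ∈ Γ l) ∧ ∑ l, β l = 0 := by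
  obtain ⟨u, hu, hu0⟩ := (Submodule.ne_bot_iff _).1 hx
  obtain ⟨a, β, h, hβ⟩ := (mem_eigenspace_pasting_iff hn).1 hu
  by_cases ha : a = 0
  · subst ha
    left
    obtain ⟨l, hl⟩ : ∃ l, u l ≠ 0 := by
      by_contra! hall
      exact hu0 (PiLp.ext hall)
    have hls : l ∈ s := (hs l).2 (mem_pointSpectrum_kerPi₁_iff.2 ⟨u l, β l, hl, h l⟩)
    have hpos : 0 < s.card := Finset.card_pos.2 ⟨l, hls⟩
    have hmult := eigenMultiplicity_pasting_of_mem hg hker hn hfun s hs ⟨l, hls⟩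
    -- A single eigenvalue among the `A_l` would make the multiplicity `1 - 1 = 0`.
    by_contra hlt
    have h1 : s.card - 1 = 0 := by omega
    rw [h1, Nat.cast_zero] at hmult
    exact hx (Submodule.rank_eq_zero.1 hmult)
  · right
    refine ⟨fun l => a⁻¹ • u l, fun l => a⁻¹ * β l, fun l => ?_, ?_⟩
    · have := (Γ l).smul_mem a⁻¹ (h l)
      rwa [Prod.smul_mk, Prod.smul_mk, Prod.smul_mk, smul_comm, smul_eq_mul, smul_eq_mul,
        inv_mul_cancel₀ ha] at this
    · rw [← Finset.mul_sum, hβ, mul_zero]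

/-- Subtracting `a` times the given solution leaves first boundary value `0`. A nonzero remainder
would make `x` an eigenvalue of some `A_l`, which the first boundary value `1` of `u l` excludes. -/
theorem eigenMultiplicity_pasting_eq_one (hn : 2 ≤ n)
    (hbf : ∃ l, IsBoundaryFunction (Γ l)) {u : ∀ l, H l} {β : Fin n → ℂ}
    (hu : ∀ l, ((u l, (x : ℂ) • u l), ((1 : ℂ), β l)) ∈ Γ l) (hβ : ∑ l, β l = 0) :
    eigenMultiplicity (pasting hn Γ) x = 1 := by
  have hmem : WithLp.toLp 2 u ∈ eigenspace (pasting hn Γ) x :=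
    (mem_eigenspace_pasting_iff hn).2 ⟨1, β, hu, hβ⟩
  refine rank_eq_one ⟨_, hmem⟩ ?_ ?_
  · intro h0
    -- The tuple `u` is nonzero: if `u l = 0`, then `(1; β l)` lies in `mul (Γ l)`.
    obtain ⟨l, hl⟩ := hbf
    have hul : u l = 0 := congrArg (fun v : PiLp 2 H => v l) (Subtype.ext_iff.1 h0)
    have := hu l
    rw [hul, smul_zero] at this
    exact one_ne_zero (hl _ _ this).1
  · rintro ⟨w, hw⟩
    obtain ⟨a, b, hw', -⟩ := (mem_eigenspace_pasting_iff hn).1 hw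
    refine ⟨a, Subtype.ext (PiLp.ext fun l => ?_)⟩
    change a • u l = w l
    have hsub := (Γ l).sub_mem (hw' l) ((Γ l).smul_mem a (hu l))
    simp only [Prod.smul_mk, Prod.mk_sub_mk, smul_comm a, ← smul_sub, smul_eq_mul, mul_one,
      sub_self] at hsub
    by_contra hne
    have hx : (x : ℂ) ∈ pointSpectrum (kerPi₁ (Γ l)) :=
      mem_pointSpectrum_kerPi₁_iff.2 ⟨_, _, sub_ne_zero.2 (Ne.symm hne), hsub⟩
    exact one_ne_zero (boundary_fst_eq_zero (hg l) (hker l) hx (hu l))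

end Multiplicity

end Paste

end Pasting

/-! ### The theorem -/

theorem theorem3 {n : ℕ} (hn : 2 ≤ n) {H : Fin n → Type*}
    [∀ l, NormedAddCommGroup (H l)] [∀ l, InnerProductSpace ℂ (H l)] [∀ l, CompleteSpace (H l)]
    (S : ∀ l, Submodule ℂ (H l × H l))
    (hS_closed : ∀ l, IsClosed (S l : Set (H l × H l)))
    (hS_symm : ∀ l, Pasting.IsSymmetricRel (S l))
    (Γ : ∀ l, Submodule ℂ ((H l × H l) × (ℂ × ℂ)))
    (hΓ : ∀ l, Pasting.IsBoundaryRelation (S l) (Γ l))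
    (hyp1 : ∀ l, Pasting.IsSimpleRel (S l))
    (hyp2 : ∀ l, Pasting.IsFunctionType (Γ l))
    (hyp3 : ∃ l, Pasting.IsBoundaryFunction (Γ l))
    (x : ℝ) :
    ((x : ℂ) ∈ Pasting.pointSpectrum (Pasting.pasting hn Γ) ↔
      Pasting.AlternativeOverlap Γ x ∨ Pasting.AlternativeNew Γ x) ∧
    (Pasting.AlternativeOverlap Γ x →
      Pasting.eigenMultiplicity (Pasting.pasting hn Γ) x =
        (({l : Fin n | (x : ℂ) ∈ Pasting.pointSpectrum (Pasting.kerPi₁ (Γ l))}.ncard - 1 : ℕ) :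
          Cardinal) ∧
      Pasting.eigenMultiplicity (Pasting.pasting hn Γ) x =
        (({l : Fin n | ∃ c : ℝ, 0 < c ∧
          Tendsto (fun ε : ℝ => ε * (Pasting.weylFunction (Γ l) (x + Complex.I * ε)).im)
            (𝓝[>] 0) (𝓝 c)}.ncard - 1 : ℕ) : Cardinal)) ∧
    (Pasting.AlternativeNew Γ x →
      Pasting.eigenMultiplicity (Pasting.pasting hn Γ) x = 1) := by
  classical
  have hg : ∀ l, ∀ p ∈ Γ l, ∀ q ∈ Γ l, Pasting.Green p q := fun l => (hΓ l).green
  have hker : ∀ l f, ((f, (x : ℂ) • f), ((0 : ℂ), (0 : ℂ))) ∈ Γ l → f = 0 := fun l f hf =>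
    (hΓ l).eq_zero_of_mem (hS_closed l) (hS_symm l) (hyp1 l) hf
  set s : Finset (Fin n) :=
    Finset.univ.filter fun l => (x : ℂ) ∈ Pasting.pointSpectrum (Pasting.kerPi₁ (Γ l)) with hs_def
  have hs : ∀ l, l ∈ s ↔ (x : ℂ) ∈ Pasting.pointSpectrum (Pasting.kerPi₁ (Γ l)) := by
    intro l
    simp [hs_def]
  have hcard : {l : Fin n | (x : ℂ) ∈ Pasting.pointSpectrum (Pasting.kerPi₁ (Γ l))}.ncard
      = s.card := by
    rw [← Set.ncard_coe_finset]
    congr 1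
    ext l
    exact (hs l).symm
  have hlim : {l : Fin n | ∃ c : ℝ, 0 < c ∧
      Tendsto (fun ε : ℝ => ε * (Pasting.weylFunction (Γ l) (x + Complex.I * ε)).im)
        (𝓝[>] 0) (𝓝 c)}
      = {l : Fin n | (x : ℂ) ∈ Pasting.pointSpectrum (Pasting.kerPi₁ (Γ l))} := by
    ext l
    exact (Pasting.mem_pointSpectrum_kerPi₁_iff_tendsto (hg l) (hker l) (hΓ l).maximal
      (hyp2 l)).symm
  have hoverlap : Pasting.AlternativeOverlap Γ x →
      Pasting.eigenMultiplicity (Pasting.pasting hn Γ) x = ((s.card - 1 : ℕ) : Cardinal) := by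
    intro h
    unfold Pasting.AlternativeOverlap at h
    rw [hcard] at h
    exact Pasting.eigenMultiplicity_pasting_of_mem hg hker hn hyp2 s hs
      (Finset.card_pos.1 (by omega))
  have hnew : Pasting.AlternativeNew Γ x →
      Pasting.eigenMultiplicity (Pasting.pasting hn Γ) x = 1 := by
    rintro ⟨m, h1, h2, h3⟩
    have hsol := fun l => (Pasting.exists_solution_iff (hg l) (hker l) (hΓ l).maximal (hyp2 l)
      (m l)).2 ⟨h1 l, h2 l⟩
    choose u hu using hsol
    exact Pasting.eigenMultiplicity_pasting_eq_one hg hker hn hyp3 hu (by exact_mod_cast h3)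
  have hmem : Pasting.eigenMultiplicity (Pasting.pasting hn Γ) x ≠ 0 →
      (x : ℂ) ∈ Pasting.pointSpectrum (Pasting.pasting hn Γ) :=
    fun h h0 => h (Submodule.rank_eq_zero.2 h0)
  refine ⟨⟨fun hx => ?_, ?_⟩, fun h => ?_, hnew⟩
  · rcases Pasting.two_le_card_or_exists_of_mem_pointSpectrum hg hker hn s hs hyp2 hx with
      h | ⟨u, β, hu, hβ⟩
    · left
      rwa [← hcard] at h
    · right
      -- At a real point, Green's identity of a solution with itself reads `0 = β - conj β`.
      have hreal : ∀ l, ((β l).re : ℂ) = β l := by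
        intro l
        have := Pasting.green_solutions (hg l) (hu l) (hu l)
        simp only [Complex.conj_ofReal, sub_self, zero_mul, map_one, mul_one, one_mul] at this
        exact Complex.conj_eq_iff_re.1 (sub_eq_zero.1 this.symm).symm
      have hlims := fun l => (Pasting.exists_solution_iff (hg l) (hker l) (hΓ l).maximal (hyp2 l)
        (β l).re).1 ⟨u l, by rw [hreal l]; exact hu l⟩
      refine ⟨fun l => (β l).re, fun l => (hlims l).1, fun l => (hlims l).2, ?_⟩
      rw [← Complex.re_sum, hβ, Complex.zero_re]
  · rintro (h | h)
    · refine hmem ?_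
      rw [hoverlap h, Nat.cast_ne_zero]
      unfold Pasting.AlternativeOverlap at h
      rw [hcard] at h
      omega
    · refine hmem ?_
      rw [hnew h]
      exact one_ne_zero
  · rw [hlim, hcard]
    exact ⟨hoverlap h, hoverlap h⟩
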